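/- Let $\mathbb{C}^{\mathrm{alg}}$ and $\mathbb{R}^{\mathrm{alg}}$ denote the fields of complex and of real numbers that are algebraic over $\mathbb{Q}$. A univariate Puiseux series is a formal series $g(X)=\sum_{k=l}^{\infty}a_kX^{k/p}$ with $l\in\mathbb{Z}$, $p\in\{1,2,3,\ldots\}$ and coefficients $a_k\in\mathbb{C}$ (put $a_k=0$ for $k<l$). Its convergence radius is $R(g)=R(f)^p\in[0,\infty]$, where $f(X)=\sum_{k=0}^{\infty}a_kX^k$, where $R(f)\in[0,\infty]$ is the supremum of all real $r>0$ such that $f$ converges on $\{z\in\mathbb{C}: |z|<r\}$ (with $\sup\emptyset=0$), and where $\infty^p=\infty$. Suppose that $g$ is algebraic over $\mathbb{C}^{\mathrm{alg}}[X]$, i.e. that there is a nonzero polynomial $P(X,T)\in\mathbb{C}^{\mathrm{alg}}[X,T]$ with $P(X,g(X))=0$. Then $R(g)\in\mathbb{R}^{\mathrm{alg}}_{>0}\cup\{\infty\}$; that is, $R(g)$ is either $\infty$ or a positive real algebraic number. -/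

import Mathlib

open scoped ENNReal

/-- The relevant radii of a univariate complex power series `f = ∑ aₖ Xᵏ`: the real numbers `r > 0`
such that `f` converges on the open disc of radius `r` around the origin. -/
def relevantRadii (f : PowerSeries ℂ) : Set ℝ :=
  {r : ℝ | 0 < r ∧ ∀ z ∈ Metric.ball (0 : ℂ) r, Summable fun k : ℕ => PowerSeries.coeff k f * z ^ k}

/-- The convergence radius of a univariate complex power series, the supremum of its relevant radii
(with `sup ∅ = 0`). -/
noncomputable def powerSeriesRadius (f : PowerSeries ℂ) : ℝ≥0∞ :=
  ⨆ r ∈ relevantRadii f, ENNReal.ofReal r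

theorem intDiv_le_intDiv_iff (p : ℕ+) (k m : ℤ) :
    (k : ℚ) / (p : ℚ) ≤ (m : ℚ) / (p : ℚ) ↔ k ≤ m := by
  have hp : (0 : ℚ) < (p : ℚ) := by exact_mod_cast p.pos
  rw [div_le_div_iff_of_pos_right hp]
  exact_mod_cast Iff.rfl

/-- The additive map `k ↦ k / p` from the integers to the rational numbers. -/
def intDivHom (p : ℕ+) : ℤ →+ ℚ where
  toFun k := (k : ℚ) / (p : ℚ)
  map_zero' := by simp
  map_add' k m := by push_cast; ring

theorem intDivHom_injective (p : ℕ+) : Function.Injective (intDivHom p) := fun k m h =>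
  le_antisymm ((intDiv_le_intDiv_iff p k m).1 h.le) ((intDiv_le_intDiv_iff p m k).1 h.ge)

/-- The Puiseux series `g(X) = ∑_{k ≥ l} aₖ X^(k/p)`, for a positive integer `p` and a family
`(aₖ)` of complex coefficients indexed by the integers and vanishing below some integer `l`
(given as the Laurent series `a = ∑_{k ≥ l} aₖ Xᵏ`). It is an element of the ring of formal series
with well-ordered rational exponents, and `g(X) = a(X^(1/p))`, so `a ↦ g` is a ring homomorphism. -/
noncomputable def puiseuxSeries (p : ℕ+) : LaurentSeries ℂ →+* HahnSeries ℚ ℂ :=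
  HahnSeries.embDomainRingHom (intDivHom p) (intDivHom_injective p) (intDiv_le_intDiv_iff p)

/-- The convergence radius of the Puiseux series `g(X) = ∑_{k ≥ l} aₖ X^(k/p)`: it is `R(f) ^ p`,
where `R(f)` is the convergence radius of the power series `f(X) = ∑_{k ≥ 0} aₖ Xᵏ`. -/
noncomputable def puiseuxRadius (p : ℕ+) (a : LaurentSeries ℂ) : ℝ≥0∞ :=
  powerSeriesRadius (PowerSeries.mk fun k : ℕ => a.coeff (k : ℤ)) ^ (p : ℕ)

/-- The field of (complex) algebraic numbers. -/
noncomputable abbrev ComplexAlg : IntermediateField ℚ ℂ := algebraicClosure ℚ ℂ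

/-- A Puiseux series `g` is algebraic over the polynomial ring `k[X]` over the field `k` of algebraic
numbers: there is a nonzero `P(X, T) ∈ k[X][T]` with `P(X, g(X)) = 0`. A polynomial in `X` is
regarded as a series with exponents in `ℕ ⊆ ℚ`. -/
def IsAlgebraicPuiseux (g : HahnSeries ℚ ℂ) : Prop :=
  ∃ P : Polynomial (Polynomial ComplexAlg), P ≠ 0 ∧
    P.eval₂ (Polynomial.eval₂RingHom (HahnSeries.C.comp (algebraMap ComplexAlg ℂ))
      (HahnSeries.single (1 : ℚ) (1 : ℂ))) g = 0

/-! Let `k` be the field of algebraic numbers. Substituting `X ^ p` for `X` and multiplying by a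
power of `X` replaces `g` by a power series `f` algebraic over `k[X]` with `R(g) = R(f) ^ p`. Some
irreducible factor `Q` of the equation of `f` kills `f`, and a resultant gives `Q A + Q' B = D` with
`0 ≠ D ∈ k[X]` (`Polynomial.exists_root_bezout_derivative`). In particular `Q'(f) ≠ 0`.

Positivity of `R(f)`: a Newton–Hensel substitution turns `f` into a root that is simple even at the
origin. The implicit function theorem gives a convergent solution there, and formal uniqueness
identifies the two (`PowerSeries.eventually_evalsTo_of_root`).

Algebraicity: let `ρ = R(f)` be finite. If neither the leading coefficient of `Q` nor `D` vanished
on `|z| = ρ`, the roots of `Q(z, ·)` would stay bounded and simple near that circle, so `f` would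
continue across each of its points and hence to a larger disc
(`PowerSeries.exists_summable_on_larger_ball`), which is absurd. So the circle carries a zero `z` of
a nonzero polynomial over `k`. This `z` is algebraic, and so is `ρ = |z|`, because `|z|² = z * conj
z`. -/

open Filter Topology Polynomial

/-! ### Pointwise evaluation of power series -/

/-- The power series `f` converges at `z` with sum `v`. -/
def PowerSeries.EvalsTo (f : PowerSeries ℂ) (z v : ℂ) : Prop :=
  HasSum (fun k : ℕ => PowerSeries.coeff k f * z ^ k) v

namespace PowerSeries.EvalsTo

variable {f g : PowerSeries ℂ} {z v w : ℂ}

theorem summable_norm (h : f.EvalsTo z v) :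
    Summable fun k : ℕ => ‖PowerSeries.coeff k f * z ^ k‖ :=
  summable_norm_iff.2 h.summable

theorem add (hf : f.EvalsTo z v) (hg : g.EvalsTo z w) : (f + g).EvalsTo z (v + w) := by
  unfold PowerSeries.EvalsTo
  simpa only [map_add, add_mul] using HasSum.add hf hg

/-- Summability in `ℂ` is absolute, so the Cauchy product applies. -/
theorem mul (hf : f.EvalsTo z v) (hg : g.EvalsTo z w) : (f * g).EvalsTo z (v * w) := by
  have h := tsum_mul_tsum_eq_tsum_sum_antidiagonal_of_summable_norm hf.summable_norm
    hg.summable_norm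
  have hs := (summable_norm_sum_mul_antidiagonal_of_summable_norm hf.summable_norm
    hg.summable_norm).of_norm
  rw [HasSum.tsum_eq hf, HasSum.tsum_eq hg] at h
  unfold PowerSeries.EvalsTo
  rw [h]
  refine hs.hasSum.congr_fun fun n => ?_
  rw [PowerSeries.coeff_mul, Finset.sum_mul]
  refine Finset.sum_congr rfl fun ij hij => ?_
  rw [← Finset.HasAntidiagonal.mem_antidiagonal.1 hij, pow_add]
  ring

theorem coe_polynomial (q : ℂ[X]) (z : ℂ) : (q : PowerSeries ℂ).EvalsTo z (q.eval z) := by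
  unfold PowerSeries.EvalsTo
  rw [Polynomial.eval_eq_sum, Polynomial.sum]
  simp only [Polynomial.coeff_coe]
  exact hasSum_sum_of_ne_finset_zero fun k hk => by
    rw [Polynomial.notMem_support_iff.1 hk, zero_mul]

theorem eval₂ (P : ℂ[X][X]) (hf : f.EvalsTo z v) :
    (P.eval₂ Polynomial.coeToPowerSeries.ringHom f).EvalsTo z (P.evalEval z v) := by
  induction P using Polynomial.induction_on with
  | C q =>
    rw [Polynomial.eval₂_C, Polynomial.evalEval_C]
    exact coe_polynomial q z
  | add p q hp hq => simpa only [Polynomial.eval₂_add, Polynomial.evalEval_add] using hp.add hq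
  | monomial n q h =>
    rw [pow_succ, ← mul_assoc, Polynomial.eval₂_mul_X, Polynomial.evalEval_mul,
      Polynomial.evalEval_X]
    exact h.mul hf

theorem eq_sum (h : f.EvalsTo z v) (h' : f.EvalsTo z w) : v = w := HasSum.unique h h'

theorem shift_iff (m : ℕ) (hz : z ≠ 0) :
    (Summable fun k : ℕ => PowerSeries.coeff (k + m) f * z ^ k) ↔
      Summable fun k : ℕ => PowerSeries.coeff k f * z ^ k := by
  rw [← summable_nat_add_iff (f := fun k : ℕ => PowerSeries.coeff k f * z ^ k) m,
    ← summable_mul_right_iff (pow_ne_zero m hz)]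
  simp only [pow_add, mul_assoc]

end PowerSeries.EvalsTo

/-! ### Power series and analytic germs; the implicit function theorem -/

theorem hasFPowerSeriesAt_ofScalars_iff {f : PowerSeries ℂ} {F : ℂ → ℂ} :
    HasFPowerSeriesAt F (FormalMultilinearSeries.ofScalars ℂ fun k => PowerSeries.coeff k f) 0 ↔
      ∀ᶠ z in 𝓝 0, f.EvalsTo z (F z) := by
  rw [hasFPowerSeriesAt_iff]
  simp only [PowerSeries.EvalsTo, FormalMultilinearSeries.coeff_ofScalars, smul_eq_mul, zero_add,
    mul_comm]

theorem PowerSeries.eq_of_eventually_evalsTo {f g : PowerSeries ℂ} {F : ℂ → ℂ}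
    (hf : ∀ᶠ z in 𝓝 0, f.EvalsTo z (F z)) (hg : ∀ᶠ z in 𝓝 0, g.EvalsTo z (F z)) : f = g := by
  have h := (hasFPowerSeriesAt_ofScalars_iff.2 hf).eq_formalMultilinearSeries
    (hasFPowerSeriesAt_ofScalars_iff.2 hg)
  ext k
  have := congrArg (fun p => FormalMultilinearSeries.coeff p k) h
  simpa only [FormalMultilinearSeries.coeff_ofScalars] using this

theorem AnalyticAt.exists_evalsTo {F : ℂ → ℂ} (hF : AnalyticAt ℂ F 0) :
    ∃ f : PowerSeries ℂ, ∀ᶠ z in 𝓝 0, f.EvalsTo z (F z) := by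
  obtain ⟨p, hp⟩ := hF
  refine ⟨PowerSeries.mk p.coeff, ?_⟩
  rw [hasFPowerSeriesAt_iff] at hp
  simpa only [PowerSeries.EvalsTo, PowerSeries.coeff_mk, smul_eq_mul, zero_add, mul_comm] using hp

theorem Polynomial.analyticAt_evalEval (P : ℂ[X][X]) (u : ℂ × ℂ) :
    AnalyticAt ℂ (fun v : ℂ × ℂ => P.evalEval v.1 v.2) u := by
  induction P using Polynomial.induction_on' with
  | add p q hp hq => 
    simp only [Polynomial.evalEval_add]
    exact hp.add hq
  | monomial n q =>
    simp only [← Polynomial.C_mul_X_pow_eq_monomial, Polynomial.evalEval_mul,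
      Polynomial.evalEval_pow, Polynomial.evalEval_X, Polynomial.evalEval_C]
    refine AnalyticAt.mul ?_ (analyticAt_snd.pow n)
    have := (analyticAt_fst (𝕜 := ℂ) (p := u)).aeval_polynomial q
    simpa using this

theorem Polynomial.hasDerivAt_evalEval (P : ℂ[X][X]) (z t : ℂ) :
    HasDerivAt (fun s => P.evalEval z s) (P.derivative.evalEval z t) t := by
  simp only [← Polynomial.map_evalRingHom_eval]
  rw [← Polynomial.derivative_map]
  exact Polynomial.hasDerivAt _ t

open scoped ContDiff in
/-- The analytic implicit function theorem for a simple root of a bivariate polynomial. -/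
theorem Polynomial.exists_analyticAt_evalEval_eq_zero_iff (P : ℂ[X][X]) {z₀ t₀ : ℂ}
    (h : P.evalEval z₀ t₀ = 0) (h' : P.derivative.evalEval z₀ t₀ ≠ 0) :
    ∃ ψ : ℂ → ℂ, AnalyticAt ℂ ψ z₀ ∧ ψ z₀ = t₀ ∧
      ∀ᶠ v : ℂ × ℂ in 𝓝 (z₀, t₀), P.evalEval v.1 v.2 = 0 ↔ ψ v.1 = v.2 := by
  have han := P.analyticAt_evalEval (z₀, t₀)
  have cd : ContDiffAt ℂ ω (fun v : ℂ × ℂ => P.evalEval v.1 v.2) (z₀, t₀) := han.contDiffAt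
  have hone : (fderiv ℂ (fun v : ℂ × ℂ => P.evalEval v.1 v.2) (z₀, t₀) ∘L .inr ℂ ℂ ℂ) 1 =
      P.derivative.evalEval z₀ t₀ := by
    have h1 : HasFDerivAt (fun s : ℂ => (z₀, s)) (.inr ℂ ℂ ℂ) t₀ := hasFDerivAt_prodMk_right z₀ t₀
    have h2 := (han.differentiableAt.hasFDerivAt.comp t₀ h1).hasDerivAt
    exact h2.unique (P.hasDerivAt_evalEval z₀ t₀)
  have hinv : (fderiv ℂ (fun v : ℂ × ℂ => P.evalEval v.1 v.2) (z₀, t₀) ∘L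
      .inr ℂ ℂ ℂ).IsInvertible := by
    -- The partial derivative in `t` is multiplication by the nonzero number `P'(z₀, t₀)`.
    refine ⟨ContinuousLinearEquiv.unitsEquivAut ℂ (Units.mk0 _ h'), ?_⟩
    ext
    rw [hone]
    simp
  refine ⟨cd.implicitFunction (by simp) hinv, (cd.contDiffAt_implicitFunction (by simp)
    hinv).analyticAt, cd.implicitFunction_apply_self (by simp) hinv, ?_⟩
  have := cd.eventually_apply_eq_iff_implicitFunction (by simp) hinv
  simpa only [h] using this

/-! ### Convergence of formal algebraic power series -/

theorem PowerSeries.evalsTo_zero (f : PowerSeries ℂ) :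
    f.EvalsTo 0 (PowerSeries.constantCoeff f) := by
  have := hasSum_single (f := fun k : ℕ => PowerSeries.coeff k f * (0 : ℂ) ^ k) 0 fun k hk => by
    simp [hk]
  simpa [PowerSeries.EvalsTo] using this

theorem PowerSeries.constantCoeff_eval₂ (P : ℂ[X][X]) (f : PowerSeries ℂ) :
    PowerSeries.constantCoeff (P.eval₂ Polynomial.coeToPowerSeries.ringHom f) =
      P.evalEval 0 (PowerSeries.constantCoeff f) :=
  (PowerSeries.evalsTo_zero _).eq_sum (f.evalsTo_zero.eval₂ P)

/-- Second order Taylor expansion of `P.eval₂ φ` at `x`. -/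
theorem Polynomial.exists_eval₂_add {R S : Type*} [CommRing R] [CommRing S] (φ : R →+* S)
    (P : R[X]) (x y : S) :
    ∃ k, P.eval₂ φ (x + y) = P.eval₂ φ x + P.derivative.eval₂ φ x * y + k * y ^ 2 := by
  obtain ⟨k, hk⟩ := (P.map φ).binomExpansion x y
  refine ⟨k, ?_⟩
  simpa only [Polynomial.derivative_map, Polynomial.eval_map] using hk

/-- A power series which is a simple root, also at `0`, of a polynomial over `ℂ[X]` is the only
root with its constant coefficient. -/
theorem PowerSeries.eq_of_eval₂_eq_zero {F : ℂ[X][X]} {u g : PowerSeries ℂ}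
    (hu : F.eval₂ Polynomial.coeToPowerSeries.ringHom u = 0)
    (hg : F.eval₂ Polynomial.coeToPowerSeries.ringHom g = 0)
    (h : PowerSeries.constantCoeff g = PowerSeries.constantCoeff u)
    (h' : F.derivative.evalEval 0 (PowerSeries.constantCoeff u) ≠ 0) : g = u := by
  obtain ⟨k, hk⟩ := Polynomial.exists_eval₂_add Polynomial.coeToPowerSeries.ringHom F u (g - u)
  rw [add_sub_cancel, hu, hg] at hk
  have hmul : (g - u) * (F.derivative.eval₂ Polynomial.coeToPowerSeries.ringHom u +
      k * (g - u)) = 0 := by linear_combination -hk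
  rcases mul_eq_zero.1 hmul with h0 | h0
  · exact sub_eq_zero.1 h0
  -- The second factor has constant coefficient `F'(0, u(0)) ≠ 0`, so it cannot vanish.
  · have := congrArg PowerSeries.constantCoeff h0
    rw [map_add, map_mul, map_sub, h, sub_self, mul_zero, add_zero, map_zero,
      PowerSeries.constantCoeff_eval₂] at this
    exact absurd this h'

/-- The Taylor series of the implicit function is a formal root with the constant coefficient of
`u`, so formal uniqueness makes it equal to `u`. -/
theorem PowerSeries.eventually_evalsTo_of_simple_root {F : ℂ[X][X]} {u : PowerSeries ℂ}
    (hu : F.eval₂ Polynomial.coeToPowerSeries.ringHom u = 0)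
    (h' : F.derivative.evalEval 0 (PowerSeries.constantCoeff u) ≠ 0) :
    ∃ ψ : ℂ → ℂ, ∀ᶠ z in 𝓝 0, u.EvalsTo z (ψ z) := by
  have h0 : F.evalEval 0 (PowerSeries.constantCoeff u) = 0 := by
    rw [← PowerSeries.constantCoeff_eval₂, hu, map_zero]
  obtain ⟨ψ, hψ, hψ0, hev⟩ := F.exists_analyticAt_evalEval_eq_zero_iff h0 h'
  obtain ⟨g, hg⟩ := hψ.exists_evalsTo
  have hroot : ∀ᶠ z in 𝓝 0, F.evalEval z (ψ z) = 0 := by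
    have ht : Tendsto (fun z => (z, ψ z)) (𝓝 0) (𝓝 (0, PowerSeries.constantCoeff u)) := by
      have := continuousAt_id.prodMk hψ.continuousAt
      simpa only [ContinuousAt, id, hψ0] using this
    filter_upwards [ht.eventually hev] with z hz using hz.2 rfl
  have hg0 : PowerSeries.constantCoeff g = PowerSeries.constantCoeff u := by
    rw [← hψ0]
    exact g.evalsTo_zero.eq_sum hg.self_of_nhds
  have hgF : F.eval₂ Polynomial.coeToPowerSeries.ringHom g = 0 := by
    refine PowerSeries.eq_of_eventually_evalsTo (F := fun _ => 0) ?_ (Eventually.of_forall fun z =>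
      by simpa using PowerSeries.EvalsTo.coe_polynomial 0 z)
    filter_upwards [hg, hroot] with z hz hz0
    rw [← hz0]
    exact hz.eval₂ F
  rw [← PowerSeries.eq_of_eval₂_eq_zero hu hgF hg0 h']
  exact ⟨ψ, hg⟩

theorem Polynomial.exists_eq_X_pow_mul_of_coe {q : ℂ[X]} {n : ℕ} {g : PowerSeries ℂ}
    (h : (q : PowerSeries ℂ) = PowerSeries.X ^ n * g) :
    ∃ v : ℂ[X], q = Polynomial.X ^ n * v ∧ (v : PowerSeries ℂ) = g := by
  have hdvd : Polynomial.X ^ n ∣ q := by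
    rw [Polynomial.X_pow_dvd_iff]
    intro d hd
    rw [← Polynomial.coeff_coe, h, PowerSeries.coeff_X_pow_mul', if_neg hd.not_ge]
  obtain ⟨v, rfl⟩ := hdvd
  refine ⟨v, rfl, ?_⟩
  rw [Polynomial.coe_mul, Polynomial.coe_pow, Polynomial.coe_X] at h
  exact mul_left_cancel₀ (pow_ne_zero n PowerSeries.X_ne_zero) h

/-- A formal power series which is a simple root of a polynomial over `ℂ[X]` converges near `0`. -/
theorem PowerSeries.eventually_evalsTo_of_root {Q : ℂ[X][X]} {f : PowerSeries ℂ}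
    (hf : Q.eval₂ Polynomial.coeToPowerSeries.ringHom f = 0)
    (hf' : Q.derivative.eval₂ Polynomial.coeToPowerSeries.ringHom f ≠ 0) :
    ∃ F : ℂ → ℂ, ∀ᶠ z in 𝓝 0, f.EvalsTo z (F z) := by
  -- With `e` the order of `Q'(f)`, write `f = B + X^(e+1) u`, where `B` is a polynomial. Then `Q(B
  -- + X^(e+1) T)` turns out to be divisible by `X^(2e+1)`, with quotient `w + v T + X k T²` and
  -- `v(0) ≠ 0`; `u` is a root of this quotient, simple at the origin.
  obtain ⟨e, h, hh0, hh⟩ : ∃ (e : ℕ) (h : PowerSeries ℂ), PowerSeries.constantCoeff h ≠ 0 ∧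
      Q.derivative.eval₂ Polynomial.coeToPowerSeries.ringHom f = PowerSeries.X ^ e * h :=
    ⟨_, _, PowerSeries.constantCoeff_divXPowOrder_eq_zero_iff.not.2 hf',
      PowerSeries.X_pow_order_mul_divXPowOrder.symm⟩
  set B : ℂ[X] := PowerSeries.trunc (e + 1) f with hB
  set u : PowerSeries ℂ := PowerSeries.mk fun k => PowerSeries.coeff (k + (e + 1)) f with hu
  have hfB : f = (B : PowerSeries ℂ) + PowerSeries.X ^ (e + 1) * u := by
    rw [add_comm]
    exact PowerSeries.eq_X_pow_mul_shift_add_trunc (e + 1) f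
  have hcoe : ∀ P : ℂ[X][X], P.eval₂ Polynomial.coeToPowerSeries.ringHom (B : PowerSeries ℂ) =
      ((P.eval B : ℂ[X]) : PowerSeries ℂ) := fun P =>
    Polynomial.eval₂_at_apply Polynomial.coeToPowerSeries.ringHom B
  obtain ⟨k₁, hk₁⟩ := Polynomial.exists_eval₂_add Polynomial.coeToPowerSeries.ringHom
    Q.derivative (B : PowerSeries ℂ) (PowerSeries.X ^ (e + 1) * u)
  rw [← hfB, hh, hcoe, hcoe] at hk₁
  -- `Q'(B)` and `Q'(f)` agree modulo `X^(e+1)`, so `Q'(B)` also has order exactly `e`.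
  obtain ⟨v, hv, hvs⟩ := Polynomial.exists_eq_X_pow_mul_of_coe (q := Q.derivative.eval B) (n := e)
    (g := h - PowerSeries.X * ((Q.derivative.derivative.eval B : ℂ[X]) : PowerSeries ℂ) * u -
      k₁ * PowerSeries.X ^ (e + 2) * u ^ 2) (by linear_combination -hk₁)
  have hv0 : v.eval 0 ≠ 0 := by
    have := congrArg PowerSeries.constantCoeff hvs
    simp only [map_sub, map_mul, map_pow, PowerSeries.constantCoeff_X, zero_mul, mul_zero,
      zero_pow (Nat.succ_ne_zero _), sub_zero, Polynomial.constantCoeff_coe] at this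
    rw [← Polynomial.coeff_zero_eq_eval_zero, this]
    exact hh0
  set ev : ℂ[X][X] →+* PowerSeries ℂ :=
    Polynomial.eval₂RingHom Polynomial.coeToPowerSeries.ringHom u with hev
  obtain ⟨k, hk⟩ := Polynomial.exists_eval₂_add (Polynomial.C : ℂ[X] →+* ℂ[X][X]) Q
    (Polynomial.C B) (Polynomial.C (Polynomial.X ^ (e + 1)) * Polynomial.X)
  have hCB : ∀ P : ℂ[X][X], P.eval₂ (Polynomial.C : ℂ[X] →+* ℂ[X][X]) (Polynomial.C B) =
      Polynomial.C (P.eval B) := fun P => Polynomial.eval₂_at_apply Polynomial.C B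
  have hevC : ∀ q : ℂ[X], ev (Polynomial.C q) = (q : PowerSeries ℂ) := fun q => by
    simp [hev]
  have hevX : ev Polynomial.X = u := by simp [hev]
  have hevQ : ev (Q.eval₂ Polynomial.C (Polynomial.C B +
      Polynomial.C (Polynomial.X ^ (e + 1)) * Polynomial.X)) = 0 := by
    rw [Polynomial.hom_eval₂, map_add, map_mul, hevC, hevC, hevX, Polynomial.coe_pow,
      Polynomial.coe_X, ← hfB, ← hf]
    congr 1
    exact RingHom.ext hevC
  have hk' := congrArg ev hk
  rw [hevQ, hCB, hCB, map_add ev, map_add ev, map_mul ev, map_mul ev, map_mul ev, map_pow ev,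
    map_mul ev, hevC, hevC, hevC, hevX, hv, Polynomial.coe_mul, Polynomial.coe_pow,
    Polynomial.coe_pow, Polynomial.coe_X] at hk'
  obtain ⟨w, hw, hws⟩ := Polynomial.exists_eq_X_pow_mul_of_coe (q := Q.eval B) (n := 2 * e + 1)
    (g := -((v : PowerSeries ℂ) * u + PowerSeries.X * ev k * u ^ 2)) (by linear_combination -hk')
  obtain ⟨ψ, hψ⟩ := PowerSeries.eventually_evalsTo_of_simple_root (u := u)
    (F := Polynomial.C w + Polynomial.C v * Polynomial.X +
      Polynomial.C Polynomial.X * (k * Polynomial.X ^ 2)) (by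
        change ev _ = 0
        simp only [map_add, map_mul, map_pow, hevC, hevX, hws, Polynomial.coe_X]
        ring) (by
        simp only [Polynomial.derivative_add, Polynomial.derivative_mul, Polynomial.derivative_C,
          Polynomial.derivative_X, Polynomial.evalEval_add, Polynomial.evalEval_mul,
          Polynomial.evalEval_C, Polynomial.evalEval_zero, Polynomial.evalEval_one,
          Polynomial.eval_X]
        simpa using hv0)
  refine ⟨fun z => B.eval z + z ^ (e + 1) * ψ z, ?_⟩
  filter_upwards [hψ] with z hz
  rw [hfB]
  refine (PowerSeries.EvalsTo.coe_polynomial B z).add (PowerSeries.EvalsTo.mul ?_ hz)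
  simpa using PowerSeries.EvalsTo.coe_polynomial (Polynomial.X ^ (e + 1)) z

/-! ### Analytic continuation across the boundary circle -/

/-- A function on an open disc that continues analytically across each point of the boundary circle
continues analytically to a larger concentric disc. -/
theorem exists_analyticOnNhd_ball_of_forall_sphere {b : ℂ → ℂ} {ρ : ℝ} (hρ : 0 < ρ)
    (hb : AnalyticOnNhd ℂ b (Metric.ball 0 ρ))
    (H : ∀ z₀ : ℂ, ‖z₀‖ = ρ → ∃ r > 0, ∃ ψ : ℂ → ℂ, AnalyticOnNhd ℂ ψ (Metric.ball z₀ r) ∧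
      Set.EqOn ψ b (Metric.ball z₀ r ∩ Metric.ball 0 ρ)) :
    ∃ ρ' > ρ, ∃ F : ℂ → ℂ, AnalyticOnNhd ℂ F (Metric.ball 0 ρ') ∧
      Set.EqOn F b (Metric.ball 0 ρ) := by
  classical
  choose! r hr ψ hψ hψb using H
  have hcl : ∀ z : ℂ, ‖z‖ = ρ → z ∈ closure (Metric.ball (0 : ℂ) ρ) := fun z hz => by
    rw [closure_ball _ hρ.ne']
    simp [hz]
  -- the branches on the half balls agree
  have key : ∀ z₁ z₂ w : ℂ, ‖z₁‖ = ρ → ‖z₂‖ = ρ → r z₂ ≤ r z₁ → w ∈ Metric.ball z₁ (r z₁ / 2) →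
      w ∈ Metric.ball z₂ (r z₂ / 2) → ψ z₁ w = ψ z₂ w := by
    intro z₁ z₂ w h₁ h₂ hle hw₁ hw₂
    rw [Metric.mem_ball] at hw₁ hw₂
    -- Halving the radii puts the centre `z₂` in the larger full ball. As `z₂` lies on the circle,
    -- the intersection of the full balls meets the disc; both branches equal `b` there, and the
    -- identity theorem applies on this convex set.
    have hz : z₂ ∈ Metric.ball z₁ (r z₁) := by
      rw [Metric.mem_ball]
      have := dist_triangle_left z₂ z₁ w
      linarith
    set W := Metric.ball z₁ (r z₁) ∩ Metric.ball z₂ (r z₂) with hW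
    have hWo : IsOpen W := Metric.isOpen_ball.inter Metric.isOpen_ball
    obtain ⟨y, hyW, hy⟩ := mem_closure_iff.1 (hcl z₂ h₂) W hWo
      ⟨hz, Metric.mem_ball_self (hr z₂ h₂)⟩
    refine ((hψ z₁ h₁).mono Set.inter_subset_left).eqOn_of_preconnected_of_eventuallyEq
      ((hψ z₂ h₂).mono Set.inter_subset_right)
      ((convex_ball z₁ _).inter (convex_ball z₂ _)).isPreconnected hyW ?_
      ⟨Metric.mem_ball.2 (by linarith [hr z₁ h₁]), Metric.mem_ball.2 (by linarith [hr z₂ h₂])⟩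
    filter_upwards [hWo.mem_nhds hyW, Metric.isOpen_ball.mem_nhds hy] with x hxW hx
    rw [hψb z₁ h₁ ⟨hxW.1, hx⟩, hψb z₂ h₂ ⟨hxW.2, hx⟩]
  let p : ℂ → ℂ → Prop := fun w z => ‖z‖ = ρ ∧ w ∈ Metric.ball z (r z / 2)
  let F : ℂ → ℂ := fun w => if w ∈ Metric.ball (0 : ℂ) ρ then b w else
    if h : ∃ z, p w z then ψ h.choose w else 0
  have hFb : Set.EqOn F b (Metric.ball 0 ρ) := fun w hw => if_pos hw
  have hFψ : ∀ z : ℂ, ‖z‖ = ρ → Set.EqOn F (ψ z) (Metric.ball z (r z / 2)) := by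
    intro z hz w hw
    by_cases hwρ : w ∈ Metric.ball (0 : ℂ) ρ
    · rw [hFb hwρ]
      exact (hψb z hz ⟨Metric.ball_subset_ball (by linarith [hr z hz]) hw, hwρ⟩).symm
    · have hex : ∃ z, p w z := ⟨z, hz, hw⟩
      have hFw : F w = ψ hex.choose w := by
        simp only [F, if_neg hwρ, dif_pos hex]
      rw [hFw]
      obtain ⟨hz', hw'⟩ := hex.choose_spec
      rcases le_total (r z) (r hex.choose) with hle | hle
      · exact key _ _ w hz' hz hle hw' hw
      · exact (key _ _ w hz hz' hle hw hw').symm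
  let S : Set ℂ := {w | AnalyticAt ℂ F w}
  have hS : IsOpen S := isOpen_analyticAt ℂ F
  have hsub : Metric.closedBall (0 : ℂ) ρ ⊆ S := by
    intro w hw
    rcases (mem_closedBall_zero_iff.1 hw).lt_or_eq with hlt | heq
    · have hwρ := mem_ball_zero_iff.2 hlt
      exact (hb w hwρ).congr (hFb.eventuallyEq_of_mem (Metric.isOpen_ball.mem_nhds hwρ)).symm
    · refine (hψ w heq w (Metric.mem_ball_self (hr w heq))).congr
        ((hFψ w heq).eventuallyEq_of_mem (Metric.ball_mem_nhds w (half_pos (hr w heq)))).symm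
  -- Analyticity is an open condition, so by compactness it spreads from the closed disc to a
  -- thickening.
  obtain ⟨δ, hδ, hδS⟩ := (isCompact_closedBall (0 : ℂ) ρ).exists_thickening_subset_open hS hsub
  rw [thickening_closedBall hδ hρ.le] at hδS
  exact ⟨δ + ρ, by linarith, F, fun w hw => hδS hw, hFb⟩

theorem PowerSeries.analyticOnNhd_tsum {f : PowerSeries ℂ} {ρ : ℝ}
    (h : ∀ z ∈ Metric.ball (0 : ℂ) ρ, Summable fun k : ℕ => PowerSeries.coeff k f * z ^ k) :
    AnalyticOnNhd ℂ (fun z => ∑' k : ℕ, PowerSeries.coeff k f * z ^ k) (Metric.ball 0 ρ) := by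
  intro z hz
  set p := FormalMultilinearSeries.ofScalars ℂ fun k => PowerSeries.coeff k f with hp
  obtain ⟨s, hzs, hsρ⟩ := exists_between (mem_ball_zero_iff.1 hz)
  have hs : 0 < s := (norm_nonneg z).trans_lt hzs
  lift s to NNReal using hs.le
  have hrad : (s : ℝ≥0∞) ≤ p.radius := by
    -- Convergence at the real point `s`, with `‖z‖ < s < ρ`, is absolute and bounds the radius from
    -- below.
    refine p.le_radius_of_summable ?_
    have := (h ((s : ℝ) : ℂ) (by simpa using hsρ)).norm
    simpa [hp, FormalMultilinearSeries.ofScalars_norm] using this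
  have hmem : z ∈ Metric.eball (0 : ℂ) p.radius := by
    rw [Metric.mem_eball, edist_zero_right]
    refine lt_of_lt_of_le ?_ hrad
    rw [enorm_eq_nnnorm, ENNReal.coe_lt_coe]
    exact hzs
  have hsum : p.sum = fun z => ∑' k : ℕ, PowerSeries.coeff k f * z ^ k := by
    ext w
    simp only [FormalMultilinearSeries.sum, hp, FormalMultilinearSeries.ofScalars_apply_eq,
      smul_eq_mul]
  rw [← hsum]
  exact (p.hasFPowerSeriesOnBall (pos_of_gt (Metric.mem_eball.1 hmem))).analyticAt_of_mem hmem

/-- The Taylor series of `F` at `0` converges on the whole disc, and it is `f` because the germs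
agree. -/
theorem PowerSeries.summable_of_differentiableOn {f : PowerSeries ℂ} {F : ℂ → ℂ} {ρ : ℝ}
    (hρ : 0 < ρ) (hF : DifferentiableOn ℂ F (Metric.ball 0 ρ))
    (h : ∀ᶠ z in 𝓝 0, f.EvalsTo z (F z)) {z : ℂ} (hz : z ∈ Metric.ball (0 : ℂ) ρ) :
    Summable fun k : ℕ => PowerSeries.coeff k f * z ^ k := by
  set g : PowerSeries ℂ := PowerSeries.mk fun n => (n.factorial : ℂ)⁻¹ * iteratedDeriv n F 0
  have hg : ∀ w ∈ Metric.ball (0 : ℂ) ρ, g.EvalsTo w (F w) := fun w hw => by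
    have := Complex.hasSum_taylorSeries_on_ball hF hw
    refine HasSum.congr_fun this fun n => ?_
    simp only [g, PowerSeries.coeff_mk, smul_eq_mul, sub_zero]
    ring
  rw [PowerSeries.eq_of_eventually_evalsTo h
    (eventually_of_mem (Metric.ball_mem_nhds 0 hρ) hg)]
  exact (hg z hz).summable

/-- The roots `t` of `P(z, t)` stay bounded near a point where the leading coefficient of `P` does
not vanish. -/
theorem Polynomial.eventually_norm_le_of_evalEval_eq_zero (P : ℂ[X][X]) {z₀ : ℂ}
    (h : P.leadingCoeff.eval z₀ ≠ 0) :
    ∃ M : ℝ, ∀ᶠ z in 𝓝 z₀, ∀ t : ℂ, P.evalEval z t = 0 → ‖t‖ ≤ M := by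
  -- Cauchy's root bound with the maximum of the coefficients replaced by their sum, which is
  -- visibly continuous in `z`.
  let G : ℂ → ℝ := fun z =>
    (∑ i ∈ Finset.range P.natDegree, ‖(P.coeff i).eval z‖) / ‖P.leadingCoeff.eval z‖ + 1
  have hG : ContinuousAt G z₀ := by
    refine ContinuousAt.add (ContinuousAt.div ?_ ?_ (norm_ne_zero_iff.2 h)) continuousAt_const
    · exact (continuous_finsetSum _ fun i _ => (P.coeff i).continuous.norm).continuousAt
    · exact P.leadingCoeff.continuous.norm.continuousAt
  refine ⟨G z₀ + 1, ?_⟩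
  filter_upwards [hG.eventually_lt_const (lt_add_one (G z₀)),
    P.leadingCoeff.continuous.continuousAt.eventually_ne h] with z hz hlc t ht
  have hlc' : (Polynomial.evalRingHom z) P.leadingCoeff ≠ 0 := hlc
  set p := P.map (Polynomial.evalRingHom z) with hp
  have hlead : p.leadingCoeff = P.leadingCoeff.eval z :=
    Polynomial.leadingCoeff_map_of_leadingCoeff_ne_zero _ hlc'
  have hdeg : p.natDegree = P.natDegree :=
    Polynomial.natDegree_map_of_leadingCoeff_ne_zero _ hlc'
  have hp0 : p ≠ 0 := fun h0 => hlc (by rw [← hlead, h0, Polynomial.leadingCoeff_zero])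
  have hroot : p.IsRoot t := by
    rw [Polynomial.IsRoot, hp, Polynomial.map_evalRingHom_eval, ht]
  have hlt : ‖t‖ < (p.cauchyBound : ℝ) := Polynomial.IsRoot.norm_lt_cauchyBound hp0 hroot
  refine hlt.le.trans (le_trans ?_ hz.le)
  have hle : ((Finset.range p.natDegree).sup fun i => ‖p.coeff i‖₊) ≤
      ∑ i ∈ Finset.range p.natDegree, ‖p.coeff i‖₊ :=
    Finset.sup_le fun i hi => Finset.single_le_sum (f := fun i => ‖p.coeff i‖₊)
      (fun _ _ => zero_le) hi
  have hle' := NNReal.coe_le_coe.2 hle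
  simp only [Polynomial.cauchyBound, NNReal.coe_add, NNReal.coe_div, coe_nnnorm, NNReal.coe_one, G]
  rw [NNReal.coe_sum] at hle'
  simp only [coe_nnnorm, hdeg] at hle' ⊢
  rw [hlead]
  gcongr
  refine hle'.trans_eq (Finset.sum_congr rfl fun i _ => ?_)
  rw [hp, Polynomial.coeff_map, Polynomial.coe_evalRingHom]

/-- An algebraic function on a disc continues analytically across a boundary point at which the
leading coefficient of its equation does not vanish and the equation has only simple roots. -/
theorem Polynomial.exists_analyticOnNhd_of_mem_sphere {Q : ℂ[X][X]} {b : ℂ → ℂ} {ρ : ℝ}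
    (hρ : 0 < ρ) (hb : AnalyticOnNhd ℂ b (Metric.ball 0 ρ))
    (hroot : ∀ z ∈ Metric.ball (0 : ℂ) ρ, Q.evalEval z (b z) = 0) {z₀ : ℂ} (hz₀ : ‖z₀‖ = ρ)
    (hlc : Q.leadingCoeff.eval z₀ ≠ 0)
    (hsimple : ∀ t, Q.evalEval z₀ t = 0 → Q.derivative.evalEval z₀ t ≠ 0) :
    ∃ r > 0, ∃ ψ : ℂ → ℂ, AnalyticOnNhd ℂ ψ (Metric.ball z₀ r) ∧
      Set.EqOn ψ b (Metric.ball z₀ r ∩ Metric.ball 0 ρ) := by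
  have hcl : z₀ ∈ closure (Metric.ball (0 : ℂ) ρ) := by
    rw [closure_ball _ hρ.ne']
    simp [hz₀]
  obtain ⟨x, hx, hxz⟩ := mem_closure_iff_seq_limit.1 hcl
  obtain ⟨M, hM⟩ := Q.eventually_norm_le_of_evalEval_eq_zero hlc
  have hbdd : ∀ᶠ n in atTop, b (x n) ∈ Metric.closedBall (0 : ℂ) M := by
    filter_upwards [hxz.eventually hM] with n hn
    exact mem_closedBall_zero_iff.2 (hn _ (hroot _ (hx n)))
  -- `b` need not be known to have a limit at `z₀`: a cluster value `t₀` of its bounded values is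
  -- enough, since it is a root and hence a simple one.
  obtain ⟨t₀, -, φ, hφ, ht₀⟩ :=
    tendsto_subseq_of_frequently_bounded Metric.isBounded_closedBall hbdd.frequently
  have hlim : Tendsto (fun n => (x (φ n), b (x (φ n)))) atTop (𝓝 (z₀, t₀)) :=
    (hxz.comp hφ.tendsto_atTop).prodMk_nhds ht₀
  have hQ0 : Q.evalEval z₀ t₀ = 0 := by
    have := (Q.analyticAt_evalEval (z₀, t₀)).continuousAt.tendsto.comp hlim
    refine tendsto_nhds_unique this ?_
    refine tendsto_const_nhds.congr fun n => ?_
    exact (hroot _ (hx (φ n))).symm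
  obtain ⟨ψ, hψ, -, hev⟩ := Q.exists_analyticAt_evalEval_eq_zero_iff hQ0 (hsimple t₀ hQ0)
  obtain ⟨r₁, hr₁, hψan⟩ := Metric.eventually_nhds_iff_ball.1 hψ.eventually_analyticAt
  obtain ⟨r₂, hr₂, hiff⟩ := Metric.eventually_nhds_iff_ball.1 hev
  have hr : 0 < min r₁ r₂ := lt_min hr₁ hr₂
  refine ⟨min r₁ r₂, hr, ψ, fun z hz => hψan z (Metric.ball_subset_ball (min_le_left _ _) hz), ?_⟩
  -- At one point `w` of the sequence, `(w, b w)` lies where the zero set is the graph of `ψ`. So `ψ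
  -- = b` near `w`, then on the whole convex intersection.
  obtain ⟨n, hn⟩ := (hlim.eventually (Metric.ball_mem_nhds (z₀, t₀) hr)).exists
  rw [← Metric.mem_ball, ← ball_prod_same] at hn
  set w := x (φ n) with hw
  have hwρ : w ∈ Metric.ball (0 : ℂ) ρ := hx (φ n)
  refine AnalyticOnNhd.eqOn_of_preconnected_of_eventuallyEq (𝕜 := ℂ) (z₀ := w)
    (fun z hz => hψan z (Metric.ball_subset_ball (min_le_left _ _) hz.1))
    (hb.mono Set.inter_subset_right) ((convex_ball z₀ _).inter (convex_ball 0 _)).isPreconnected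
    ⟨hn.1, hwρ⟩ ?_
  filter_upwards [Metric.isOpen_ball.mem_nhds hn.1, Metric.isOpen_ball.mem_nhds hwρ,
    (hb w hwρ).continuousAt.eventually (Metric.isOpen_ball.mem_nhds hn.2)] with y hy hyρ hby
  have hmem : (y, b y) ∈ Metric.ball (z₀, t₀) (min r₁ r₂) := by
    rw [← ball_prod_same]
    exact ⟨hy, hby⟩
  exact (hiff (y, b y) (Metric.ball_subset_ball (min_le_right _ _) hmem)).1 (hroot y hyρ)

/-- An algebraic power series converging on a disc converges on a larger disc unless the leading
coefficient or the separability of its equation degenerates on the boundary circle. -/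
theorem PowerSeries.exists_summable_on_larger_ball {Q : ℂ[X][X]} {f : PowerSeries ℂ} {ρ : ℝ}
    (hρ : 0 < ρ)
    (hconv : ∀ z ∈ Metric.ball (0 : ℂ) ρ, Summable fun k : ℕ => PowerSeries.coeff k f * z ^ k)
    (hf : Q.eval₂ Polynomial.coeToPowerSeries.ringHom f = 0)
    (hlc : ∀ z : ℂ, ‖z‖ = ρ → Q.leadingCoeff.eval z ≠ 0)
    (hsimple : ∀ z : ℂ, ‖z‖ = ρ → ∀ t, Q.evalEval z t = 0 → Q.derivative.evalEval z t ≠ 0) :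
    ∃ ρ' > ρ, ∀ z ∈ Metric.ball (0 : ℂ) ρ', Summable fun k : ℕ =>
      PowerSeries.coeff k f * z ^ k := by
  have hb := PowerSeries.analyticOnNhd_tsum hconv
  set b : ℂ → ℂ := fun z => ∑' k : ℕ, PowerSeries.coeff k f * z ^ k
  have hev : ∀ z ∈ Metric.ball (0 : ℂ) ρ, f.EvalsTo z (b z) := fun z hz => (hconv z hz).hasSum
  have hroot : ∀ z ∈ Metric.ball (0 : ℂ) ρ, Q.evalEval z (b z) = 0 := fun z hz => by
    have h1 := (hev z hz).eval₂ Q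
    rw [hf] at h1
    refine h1.eq_sum ?_
    simpa using PowerSeries.EvalsTo.coe_polynomial 0 z
  obtain ⟨ρ', hρ', F, hF, hFb⟩ := exists_analyticOnNhd_ball_of_forall_sphere hρ hb fun z hz =>
    Polynomial.exists_analyticOnNhd_of_mem_sphere hρ hb hroot hz (hlc z hz) (hsimple z hz)
  refine ⟨ρ', hρ', fun z hz => PowerSeries.summable_of_differentiableOn (hρ.trans hρ')
    hF.differentiableOn ?_ hz⟩
  filter_upwards [Metric.ball_mem_nhds (0 : ℂ) hρ] with w hw
  rw [hFb hw]
  exact hev w hw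

/-! ### Elimination -/

/-- A root of a nonzero polynomial over a unique factorization domain of characteristic zero is a
root of a polynomial `Q` such that the ideal `(Q, Q')` contains a nonzero constant. -/
theorem Polynomial.exists_root_bezout_derivative {R S : Type*} [CommRing R] [IsDomain R]
    [UniqueFactorizationMonoid R] [CharZero R] [CommRing S] [IsDomain S] {φ : R →+* S}
    (hφ : Function.Injective φ) {P : R[X]} (hP : P ≠ 0) {x : S} (hx : P.eval₂ φ x = 0) :
    ∃ (Q A B : R[X]) (D : R), Q ≠ 0 ∧ D ≠ 0 ∧ Q.eval₂ φ x = 0 ∧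
      Q * A + Q.derivative * B = Polynomial.C D := by
  classical
  obtain ⟨s, hs, hsP⟩ := WfDvdMonoid.exists_factors P hP
  obtain ⟨Q, hQs, hQx⟩ : ∃ Q ∈ s, Q.eval₂ φ x = 0 := by
    have h0 : (Polynomial.eval₂RingHom φ x) s.prod = 0 := by
      obtain ⟨u, hu⟩ := hsP.symm
      rw [← hu, map_mul, Polynomial.coe_eval₂RingHom, hx, zero_mul]
    rw [map_multiset_prod, Multiset.prod_eq_zero_iff, Multiset.mem_map] at h0
    exact h0
  have hQ := hs Q hQs
  have hdeg : Q.natDegree ≠ 0 := fun h => by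
    rw [Polynomial.eq_C_of_natDegree_eq_zero h, Polynomial.eval₂_C] at hQx
    have h0 : Q.coeff 0 = 0 := hφ (by rw [hQx, map_zero])
    exact hQ.ne_zero (by rw [Polynomial.eq_C_of_natDegree_eq_zero h, h0, Polynomial.C_0])
  -- By Gauss's lemma `Q` stays irreducible over the fraction field, hence separable in
  -- characteristic zero. Thus its resultant with `Q'`, taken as `D`, is nonzero.
  let _ : NormalizedGCDMonoid R := Classical.choice inferInstance
  have hirr : Irreducible (Q.map (algebraMap R (FractionRing R))) :=
    (hQ.isPrimitive hdeg).irreducible_iff_irreducible_map_fraction_map.1 hQ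
  have : CharZero (FractionRing R) :=
    charZero_of_injective_algebraMap (IsFractionRing.injective R (FractionRing R))
  have hcop : IsCoprime (Q.map (algebraMap R (FractionRing R)))
      (Q.derivative.map (algebraMap R (FractionRing R))) := by
    rw [← Polynomial.derivative_map]
    exact hirr.separable
  obtain ⟨A, B, -, -, hAB⟩ := Polynomial.exists_mul_add_mul_eq_C_resultant Q Q.derivative le_rfl
    le_rfl (Or.inl hdeg)
  refine ⟨Q, A, B, _, hQ.ne_zero, fun h0 => ?_, hQx, hAB⟩
  have hres := Polynomial.resultant_ne_zero _ _ hcop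
  have hinj := IsFractionRing.injective R (FractionRing R)
  rw [Polynomial.natDegree_map_eq_of_injective hinj, Polynomial.natDegree_map_eq_of_injective hinj,
    Polynomial.resultant_map_map, h0, map_zero] at hres
  exact hres rfl

/-! ### Reduction from Puiseux series to power series -/

/-- The embedding of `k[X]` into the complex power series, `k` the field of algebraic numbers. -/
noncomputable def algPolyToPowerSeries : Polynomial ComplexAlg →+* PowerSeries ℂ :=
  Polynomial.coeToPowerSeries.ringHom.comp (Polynomial.mapRingHom (algebraMap ComplexAlg ℂ))

theorem algPolyToPowerSeries_injective : Function.Injective algPolyToPowerSeries :=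
  (Polynomial.coe_injective ℂ).comp (Polynomial.map_injective _ (algebraMap ComplexAlg ℂ).injective)

theorem puiseuxSeries_injective (p : ℕ+) : Function.Injective (puiseuxSeries p) :=
  HahnSeries.embDomain_injective

/-- Since `X = (X^(1/p))^p`, coefficients in `X` become polynomials in `X^(1/p)` through `expand`.
-/
theorem puiseuxSeries_comp_algPoly (p : ℕ+) :
    (puiseuxSeries p).comp (((HahnSeries.ofPowerSeries ℤ ℂ).comp algPolyToPowerSeries).comp
      (Polynomial.expand ComplexAlg p : Polynomial ComplexAlg →+* Polynomial ComplexAlg)) =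
    Polynomial.eval₂RingHom (HahnSeries.C.comp (algebraMap ComplexAlg ℂ))
      (HahnSeries.single (1 : ℚ) (1 : ℂ)) := by
  have hp : (p : ℚ) ≠ 0 := by exact_mod_cast p.ne_zero
  have hC : ∀ c : ℂ, puiseuxSeries p (HahnSeries.C c) = HahnSeries.C c := fun c =>
    HahnSeries.embDomainRingHom_C
  have hX : puiseuxSeries p (HahnSeries.single ((p : ℕ) : ℤ) 1) = HahnSeries.single (1 : ℚ) 1 := by
    refine HahnSeries.embDomain_single.trans ?_
    have hp1 : (((p : ℕ) : ℤ) : ℚ) / (p : ℚ) = 1 := by rw [Int.cast_natCast, div_self hp]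
    exact congrArg (fun q : ℚ => HahnSeries.single q (1 : ℂ)) hp1
  refine Polynomial.ringHom_ext (fun c => ?_) ?_
  · simpa [algPolyToPowerSeries] using hC c
  · simp [algPolyToPowerSeries, hX]

/-- Multiplying by a power of `X` turns an algebraic Puiseux series into an algebraic power series
in `X^(1/p)` with the same convergence. -/
theorem IsAlgebraicPuiseux.exists_powerSeries {p : ℕ+} {a : LaurentSeries ℂ}
    (h : IsAlgebraicPuiseux (puiseuxSeries p a)) :
    ∃ (f : PowerSeries ℂ) (m : ℕ), (∀ k : ℕ, PowerSeries.coeff (k + m) f = a.coeff k) ∧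
      ∃ P : Polynomial (Polynomial ComplexAlg), P ≠ 0 ∧ P.eval₂ algPolyToPowerSeries f = 0 := by
  obtain ⟨P, hP, hPa⟩ := h
  set θ := (HahnSeries.ofPowerSeries ℤ ℂ).comp algPolyToPowerSeries with hθ
  set ex : Polynomial ComplexAlg →+* Polynomial ComplexAlg :=
    (Polynomial.expand ComplexAlg p).toRingHom
  have h1 : (P.map ex).eval₂ θ a = 0 := by
    apply puiseuxSeries_injective p
    rw [map_zero, ← hPa, ← puiseuxSeries_comp_algPoly p, Polynomial.eval₂_map, Polynomial.hom_eval₂]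
    rfl
  have hP1 : P.map ex ≠ 0 :=
    (Polynomial.map_ne_zero_iff (Polynomial.expand_injective p.pos)).2 hP
  -- Multiplication by `X ^ m` clears the pole of `a`; `scaleRoots` adjusts the equation
  -- accordingly.
  obtain ⟨m, hm⟩ : ∃ m : ℕ, -(m : ℤ) ≤ a.order := ⟨a.order.natAbs, by omega⟩
  set f : PowerSeries ℂ := PowerSeries.mk fun k => a.coeff ((k : ℤ) - m) with hf
  have hfa : HahnSeries.ofPowerSeries ℤ ℂ f = θ (Polynomial.X ^ m) * a := by
    have hX : θ (Polynomial.X ^ m) = HahnSeries.single (m : ℤ) 1 := by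
      simp [hθ, algPolyToPowerSeries]
    rw [hX]
    ext n
    rw [HahnSeries.coeff_single_mul, one_mul]
    rcases lt_or_ge n 0 with hn | hn
    · rw [HahnSeries.coeff_eq_zero_of_lt_order (x := a) (by omega)]
      refine HahnSeries.embDomain_of_notMem_range ?_
      rintro ⟨k, hk⟩
      have : (k : ℤ) = n := hk
      omega
    · lift n to ℕ using hn
      rw [HahnSeries.ofPowerSeries_apply_coeff, hf, PowerSeries.coeff_mk]
  refine ⟨f, m, fun k => ?_, (P.map ex).scaleRoots (Polynomial.X ^ m),
    Polynomial.scaleRoots_ne_zero hP1 _, ?_⟩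
  · rw [hf, PowerSeries.coeff_mk]
    congr 1
    push_cast
    ring
  · have h2 := Polynomial.scaleRoots_eval₂_eq_zero (s := Polynomial.X ^ m) θ h1
    rw [← hfa, hθ, ← Polynomial.hom_eval₂] at h2
    exact HahnSeries.ofPowerSeries_injective (h2.trans (map_zero _).symm)

/-- Dropping the first `m` terms and dividing by `z ^ m` does not affect convergence at `z ≠ 0`; at
`0` both series converge. This removes the principal part, which `puiseuxRadius` ignores. -/
theorem relevantRadii_eq_of_shift {f g : PowerSeries ℂ} {m : ℕ}
    (h : ∀ k : ℕ, PowerSeries.coeff (k + m) f = PowerSeries.coeff k g) :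
    relevantRadii g = relevantRadii f := by
  ext r
  refine and_congr_right fun _ => forall₂_congr fun z _ => ?_
  rcases eq_or_ne z 0 with rfl | hz
  · exact iff_of_true g.evalsTo_zero.summable f.evalsTo_zero.summable
  · simp only [← h]
    exact PowerSeries.EvalsTo.shift_iff m hz

/-! ### Algebraicity of the radius -/

theorem Complex.isAlgebraic_norm {z : ℂ} (hz : IsAlgebraic ℚ z) : IsAlgebraic ℚ ‖z‖ := by
  have hconj : IsAlgebraic ℚ ((starRingEnd ℂ) z) :=
    hz.algHom ((Complex.conjAe : ℂ →ₐ[ℝ] ℂ).restrictScalars ℚ)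
  have hsq : IsAlgebraic ℚ ((‖z‖ : ℂ) ^ 2) := by
    rw [← Complex.mul_conj']
    exact hz.mul hconj
  exact (isAlgebraic_algebraMap_iff (R := ℚ) (S := ℝ) (A := ℂ)
    Complex.ofReal_injective).1 (hsq.of_pow two_pos)

theorem isAlgebraic_of_eval_map_eq_zero {q : Polynomial ComplexAlg} (hq : q ≠ 0) {z : ℂ}
    (hz : (q.map (algebraMap ComplexAlg ℂ)).eval z = 0) : IsAlgebraic ℚ z := by
  have hzk : IsAlgebraic ComplexAlg z :=
    ⟨q, hq, by rw [Polynomial.aeval_def, ← Polynomial.eval_map, hz]⟩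
  have : Algebra.IsAlgebraic ℚ ComplexAlg := algebraicClosure.isAlgebraic ℚ ℂ
  exact hzk.restrictScalars ℚ

theorem summable_of_lt_powerSeriesRadius {f : PowerSeries ℂ} {z : ℂ}
    (hz : ENNReal.ofReal ‖z‖ < powerSeriesRadius f) :
    Summable fun k : ℕ => PowerSeries.coeff k f * z ^ k := by
  obtain ⟨r, hr⟩ := lt_iSup_iff.1 hz
  obtain ⟨hrf, hlt⟩ := lt_iSup_iff.1 hr
  exact hrf.2 z (mem_ball_zero_iff.2 ((ENNReal.ofReal_lt_ofReal_iff hrf.1).1 hlt))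

theorem ofReal_le_powerSeriesRadius {f : PowerSeries ℂ} {r : ℝ} (hr : r ∈ relevantRadii f) :
    ENNReal.ofReal r ≤ powerSeriesRadius f :=
  le_iSup₂ (f := fun r (_ : r ∈ relevantRadii f) => ENNReal.ofReal r) r hr

/-- The convergence radius of a power series that is algebraic over `k[X]`, `k` the field of
algebraic numbers, is infinite or a positive algebraic number. -/
theorem powerSeriesRadius_eq_top_or_isAlgebraic {f : PowerSeries ℂ}
    {P : Polynomial (Polynomial ComplexAlg)} (hP : P ≠ 0)
    (hPf : P.eval₂ algPolyToPowerSeries f = 0) :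
    powerSeriesRadius f = ∞ ∨
      ∃ r : ℝ, 0 < r ∧ IsAlgebraic ℚ r ∧ powerSeriesRadius f = ENNReal.ofReal r := by
  obtain ⟨Q, A, B, D, hQ, hD, hQf, hAB⟩ :=
    Polynomial.exists_root_bezout_derivative algPolyToPowerSeries_injective hP hPf
  set ι := algebraMap ComplexAlg ℂ
  set μ : Polynomial ComplexAlg →+* ℂ[X] := Polynomial.mapRingHom ι with hμ
  have hμinj : Function.Injective μ := Polynomial.map_injective _ ι.injective
  have hQf' : (Q.map μ).eval₂ Polynomial.coeToPowerSeries.ringHom f = 0 := by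
    rw [Polynomial.eval₂_map]
    exact hQf
  -- If `Q'(f) = 0`, evaluating the Bézout relation at `f` would give `D = 0`.
  have hder : (Q.map μ).derivative.eval₂ Polynomial.coeToPowerSeries.ringHom f ≠ 0 := fun h0 => by
    have h1 := congrArg (Polynomial.eval₂ algPolyToPowerSeries f) hAB
    rw [Polynomial.derivative_map, Polynomial.eval₂_map] at h0
    rw [Polynomial.eval₂_add, Polynomial.eval₂_mul, Polynomial.eval₂_mul, hQf, Polynomial.eval₂_C,
      show Q.derivative.eval₂ algPolyToPowerSeries f = 0 from h0, zero_mul, zero_mul,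
      add_zero] at h1
    exact hD (algPolyToPowerSeries_injective (by rw [← h1, map_zero]))
  obtain ⟨F, hF⟩ := PowerSeries.eventually_evalsTo_of_root hQf' hder
  obtain ⟨ε, hε, hεF⟩ := Metric.eventually_nhds_iff_ball.1 hF
  have hpos : 0 < powerSeriesRadius f :=
    (ENNReal.ofReal_pos.2 hε).trans_le
      (ofReal_le_powerSeriesRadius ⟨hε, fun z hz => (hεF z hz).summable⟩)
  rcases eq_or_ne (powerSeriesRadius f) ∞ with htop | htop
  · exact Or.inl htop
  set ρ := (powerSeriesRadius f).toReal with hρdef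
  have hρ : 0 < ρ := ENNReal.toReal_pos hpos.ne' htop
  have hRρ : powerSeriesRadius f = ENNReal.ofReal ρ := (ENNReal.ofReal_toReal htop).symm
  refine Or.inr ⟨ρ, hρ, ?_, hRρ⟩
  by_contra hnot
  -- A circle of transcendental radius contains no algebraic point, hence no zero of a nonzero
  -- polynomial over `ComplexAlg`.
  have hbad : ∀ z : ℂ, ‖z‖ = ρ → ∀ q : Polynomial ComplexAlg, q ≠ 0 → (μ q).eval z ≠ 0 :=
    fun z hz q hq h0 => hnot (hz ▸ Complex.isAlgebraic_norm (isAlgebraic_of_eval_map_eq_zero hq h0))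
  obtain ⟨ρ', hρ', hconv⟩ := PowerSeries.exists_summable_on_larger_ball (Q := Q.map μ) (f := f) hρ
    (fun z hz => summable_of_lt_powerSeriesRadius (by
      rw [hRρ]
      exact (ENNReal.ofReal_lt_ofReal_iff hρ).2 (mem_ball_zero_iff.1 hz))) hQf'
    (fun z hz => by
      rw [Polynomial.leadingCoeff_map_of_injective hμinj]
      exact hbad z hz _ (Polynomial.leadingCoeff_ne_zero.2 hQ))
    -- A common zero `(z, t)` of `Q` and `Q'` would force `D(z) = 0`.
    (fun z hz t ht ht' => by
      have h1 := congrArg (fun q => (Polynomial.map μ q).evalEval z t) hAB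
      simp only [Polynomial.map_add, Polynomial.map_mul, Polynomial.evalEval_add,
        Polynomial.evalEval_mul, Polynomial.map_C, Polynomial.evalEval_C] at h1
      rw [Polynomial.derivative_map] at ht'
      rw [ht, ht', zero_mul, zero_mul, add_zero] at h1
      exact hbad z hz D hD h1.symm)
  have hle := ofReal_le_powerSeriesRadius (f := f) ⟨hρ.trans hρ', hconv⟩
  rw [hRρ, ENNReal.ofReal_le_ofReal_iff hρ.le] at hle
  exact absurd hle hρ'.not_ge

theorem mainTheorem5 (p : ℕ+) (a : LaurentSeries ℂ)
    (h : IsAlgebraicPuiseux (puiseuxSeries p a)) :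
    puiseuxRadius p a = ∞ ∨
      ∃ r : ℝ, 0 < r ∧ IsAlgebraic ℚ r ∧ puiseuxRadius p a = ENNReal.ofReal r := by
  obtain ⟨f, m, hfa, P, hP, hPf⟩ := h.exists_powerSeries
  have hrad : puiseuxRadius p a = powerSeriesRadius f ^ (p : ℕ) := by
    rw [puiseuxRadius, powerSeriesRadius, powerSeriesRadius, relevantRadii_eq_of_shift (f := f)
      (m := m) fun k => by rw [hfa, PowerSeries.coeff_mk]]
  rcases powerSeriesRadius_eq_top_or_isAlgebraic hP hPf with htop | ⟨r, hr, hralg, hrf⟩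
  · exact Or.inl (by rw [hrad, htop, ENNReal.top_pow p.ne_zero])
  · exact Or.inr ⟨r ^ (p : ℕ), pow_pos hr _, hralg.pow _, by
      rw [hrad, hrf, ENNReal.ofReal_pow hr.le]⟩
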